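/- Let $A=\{a,b\}$. For a finite set $H\subset\mathbb N$ write $a^H=\sum_{h\in H}a^h$; if a polynomial in $\mathbb Z[a]$ has nonnegative coefficients it is also written $a^R$, with $R$ the finite multiset of its exponents counted with multiplicity. Let $(p,a^k)$ be the coefficient of $a^k$ in $p\in\mathbb Z[a]$, and let $p\ge q$ mean $(p,a^k)\ge(q,a^k)$ for all $k$. A code is a set $C$ of words over $A$ such that every word has at most one factorization into elements of $C$; a code is maximal if no other code over $A$ properly contains it. A pair $(P,S)$ of polynomials in $\mathbb Z\langle A\rangle$ is a positive factorization for a finite maximal code $C$ if $\sum_{w\in C}w=P(a+b-1)S+1$ and either $P,S$ or $-P,-S$ have all their coefficients in $\{0,1\}$. Let $n\ge1$ and let $(I,J)$ be a Krasner factorization of $\mathbb Z_n$, i.e. finite sets $I,J\subset\mathbb N$ with $a^Ia^J=1+a+\dots+a^{n-1}$. Let $J'$, $L_i$ $(i\in I)$, $M_j$ $(j\in J')$ and $L_{i,\ell}$ $(i\in I,\ \ell\in L_i)$ be finite subsets of $\mathbb N$, and let $$P=a^I+\sum_{i\in I}a^iba^{L_i}+\sum_{i\in I,\,\ell\in L_i}a^iba^\ell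 ba^{L_{i,\ell}},\qquad S=a^J+\sum_{j\in J'}a^{M_j}ba^j .$$ Then $(P,S)$ is a positive factorization for some finite maximal code over $A$ if and only if all of the following conditions hold: 1. $a^{L_{i,\ell}}(a-1)a^{M_j}+a^{L_{i,\ell}}+a^{M_j}\ge0$ for all $i\in I$, $\ell\in L_i$, $j\in J'\cap J$; 2. $a^{L_{i,\ell}}(a-1)a^{M_j}+a^{M_j}\ge0$ for all $i\in I$, $\ell\in L_i$, $j\in J'\setminus J$; 3. $a^{R_i}=a^{L_i}(a-1)a^J+a^J\ge0$ for all $i\in I$; 4. $\{j\in J'\mid M_j\ne\emptyset\}\subseteq\bigcup_{i\in I}R_i$; 5. $a^{M_j}(a-1)a^I+a^I\ \ge\ a^{M_j}(a-1)a^I+a^{I_j}\ \ge\ 0$ for all $j\in J'$, where $I_j=\{i\in I\mid j\in R_i\}$; 6. $a^{R_{i,\ell}}=a^{L_{i,\ell}}(a-1)a^J+a^J\ge0$ for all $i\in I$, $\ell\in L_i$; 7. for all $i\in I$, $j\in J'$, $\ell\in L_i$: if $(a^{L_i}(a-1)a^{M_j}+a^{M_j},\,a^\ell)<0$ then $j\in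 R_{i,\ell}$. -/

import Mathlib

open scoped Polynomial

noncomputable section

namespace PosFact

/-- The two-letter alphabet `A = {a, b}`. -/
inductive Letter where
  | a : Letter
  | b : Letter
  deriving DecidableEq

/-- Words over `A`. -/
abbrev Word : Type := List Letter

/-- `ℤ⟨A⟩`: polynomials in the noncommuting variables `a`, `b` with integer coefficients. -/
abbrev NCPoly : Type := MonoidAlgebra ℤ (FreeMonoid Letter)

/-- The letter `x`, as an element of `ℤ⟨A⟩`. -/
def NCPoly.var (x : Letter) : NCPoly := MonoidAlgebra.single (FreeMonoid.of x) 1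

/-- The coefficient `(P, w)` of the word `w` in `P`. -/
def NCPoly.coeffAt (P : NCPoly) (w : Word) : ℤ := P.coeff (FreeMonoid.ofList w)

/-- All the coefficients of `P` are `0` or `1`. -/
def NCPoly.IsZeroOne (P : NCPoly) : Prop := ∀ w : Word, P.coeffAt w = 0 ∨ P.coeffAt w = 1

/-- The characteristic polynomial of a finite set of words. -/
def charPoly (C : Finset Word) : NCPoly :=
  ∑ w ∈ C, MonoidAlgebra.single (FreeMonoid.ofList w) 1

/-- A code: every word has at most one factorization into elements of `C`. -/
def IsCode (C : Set Word) : Prop := InformationTheory.UniquelyDecodable C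

/-- A code that is not properly contained in another code over `A`. -/
def IsMaximalCode (C : Set Word) : Prop :=
  IsCode C ∧ ∀ C' : Set Word, IsCode C' → C ⊆ C' → C = C'

/-- `(P, S)` is a factorization for `C`, that is `C = P (A - 1) S + 1` in `ℤ⟨A⟩`. -/
def IsFactorization (P S : NCPoly) (C : Finset Word) : Prop :=
  charPoly C = P * (NCPoly.var Letter.a + NCPoly.var Letter.b - 1) * S + 1

/-- A factorization such that `P, S` or `-P, -S` have coefficients `0, 1`. -/
def IsPositiveFactorization (P S : NCPoly) (C : Finset Word) : Prop :=
  IsFactorization P S C ∧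
    ((P.IsZeroOne ∧ S.IsZeroOne) ∨ ((-P).IsZeroOne ∧ (-S).IsZeroOne))

/-- `x^H = ∑_{h ∈ H} x^h`. -/
def powSet {R : Type*} [Semiring R] (x : R) (H : Finset ℕ) : R := ∑ h ∈ H, x ^ h

/-- `a^H` as an element of `ℤ⟨A⟩`. -/
def aPow (H : Finset ℕ) : NCPoly := powSet (NCPoly.var Letter.a) H

/-- The letter `b` as an element of `ℤ⟨A⟩`. -/
def bVar : NCPoly := NCPoly.var Letter.b

/-- `a^H` as an element of `ℤ[a]`, the variable `a` being `Polynomial.X`. -/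
def pPow (H : Finset ℕ) : ℤ[X] := powSet Polynomial.X H

/-- The coefficientwise order on `ℤ[a]`: `CoeffLE p q` is `p ≤ q`. -/
def CoeffLE (p q : ℤ[X]) : Prop := ∀ k : ℕ, p.coeff k ≤ q.coeff k

/-- `(I, J)` is a Krasner factorization of the cyclic group of order `n`:
`a^I a^J = 1 + a + ... + a^(n-1)`. -/
def IsKrasner (n : ℕ) (I J : Finset ℕ) : Prop :=
  0 < n ∧ pPow I * pPow J = ∑ k ∈ Finset.range n, (Polynomial.X : ℤ[X]) ^ k

/-- `a^H (a - 1) a^K + a^K`. -/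
def hajos (H K : Finset ℕ) : ℤ[X] := pPow H * (Polynomial.X - 1) * pPow K + pPow K

/-- The exponents `R` given by `a^R = a^L (a - 1) a^J + a^J`. When this polynomial is `≥ 0`
it is `a^R` for a unique finite multiset `R`, and this is the set of the elements of `R`. -/
def expSet (L J : Finset ℕ) : Finset ℕ := (hajos L J).support

/-- `P = a^I + ∑_{i ∈ I} a^i b a^{L_i} + ∑_{i ∈ I, ℓ ∈ L_i} a^i b a^ℓ b a^{L_{i,ℓ}}`. -/
def polyP (I : Finset ℕ) (L : ℕ → Finset ℕ) (L₂ : ℕ → ℕ → Finset ℕ) : NCPoly :=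
  aPow I + ∑ i ∈ I, aPow {i} * bVar * aPow (L i)
    + ∑ i ∈ I, ∑ l ∈ L i, aPow {i} * bVar * aPow {l} * bVar * aPow (L₂ i l)

/-- `S = a^J + ∑_{j ∈ J'} a^{M_j} b a^j`. -/
def polyS (J J' : Finset ℕ) (M : ℕ → Finset ℕ) : NCPoly :=
  aPow J + ∑ j ∈ J', aPow (M j) * bVar * aPow {j}

end PosFact

end

/-! The existence of a maximal code reduces to nonnegativity of `Q = P (A - 1) S + 1`. From `1 - Q =
P (1 - A) S` one gets formally `S Q^* P = A^*`. Since `P` and `S` are nonnegative with constant term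
`1`, `Q^*` is bounded by `A^*`, so its coefficients are at most `1`. Hence `Q` is the characteristic
polynomial of a code, and evaluating both letters at `1/2` gives Kraft sum `1`, so that code is
maximal by Kraft–McMillan (`exists_isMaximalCode`).

Nonnegativity is then read off by the number of `b`'s in a word (`isNonneg_iff`). Words with no `b`,
or with more than three, impose nothing. Three `b`'s give conditions 1 and 2 verbatim.

For one `b`, multiplying by `a^J` and using `a^I (a - 1) a^J = a^n - 1` isolates condition 3
(`nonneg_of_sum_add_nonneg`). The polynomials `a^{R_i}` then have coefficients `0, 1`, so what
remains is condition 5, and condition 4 follows from it.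

For two `b`'s, conditions 3 and 5 force `a^{L_i} (a - 1) a^{M_j} + a^{L_i} + a^{M_j}` to have
coefficients `0, 1` (`coeff_hajos_add_mem`). So `a^{L_i} (a - 1) a^{M_j} + a^{M_j}` is nonnegative
off `L_i` and `-1` or `0` on `L_i`. The term `a^{R_{i,ℓ}}` must therefore be nonnegative (condition
6) and must compensate each `-1` (condition 7). -/

namespace PosFact

open Finset

/-! ### Coefficients of noncommutative polynomials -/

namespace NCPoly

@[simp] lemma coeffAt_zero (w : Word) : coeffAt 0 w = 0 := rfl

@[simp] lemma coeffAt_add (P Q : NCPoly) (w : Word) :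
    coeffAt (P + Q) w = coeffAt P w + coeffAt Q w := by simp [coeffAt]

@[simp] lemma coeffAt_sub (P Q : NCPoly) (w : Word) :
    coeffAt (P - Q) w = coeffAt P w - coeffAt Q w := by simp [coeffAt]

@[simp] lemma coeffAt_smul (c : ℤ) (P : NCPoly) (w : Word) :
    coeffAt (c • P) w = c * coeffAt P w := by
  rw [coeffAt, MonoidAlgebra.coeff_smul_apply, smul_eq_mul, coeffAt]

@[simp] lemma coeffAt_sum {ι : Type*} (s : Finset ι) (f : ι → NCPoly) (w : Word) :
    coeffAt (∑ i ∈ s, f i) w = ∑ i ∈ s, coeffAt (f i) w := by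
  simp [coeffAt, MonoidAlgebra.coeff_sum]

lemma ext_coeffAt {P Q : NCPoly} (h : ∀ w, coeffAt P w = coeffAt Q w) : P = Q := by
  apply MonoidAlgebra.coeff_injective
  ext m
  exact h (FreeMonoid.toList m)

lemma coeffAt_single (u : Word) (c : ℤ) (w : Word) :
    coeffAt (MonoidAlgebra.single (FreeMonoid.ofList u) c) w = if u = w then c else 0 := by
  classical
  rw [coeffAt, MonoidAlgebra.coeff_single, Finsupp.single_apply]
  simp only [FreeMonoid.ofList.injective.eq_iff]

lemma coeffAt_one (w : Word) : coeffAt 1 w = if w = [] then 1 else 0 := by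
  have := coeffAt_single [] 1 w
  simpa [MonoidAlgebra.one_def, eq_comm] using this

lemma coeffAt_var_mul_cons (x y : Letter) (P : NCPoly) (w : Word) :
    coeffAt (var x * P) (y :: w) = if x = y then coeffAt P w else 0 := by
  unfold coeffAt var
  split_ifs with h
  · subst h
    rw [MonoidAlgebra.coeff_single_mul_eq_mul_coeff (FreeMonoid.ofList w)]
    · simp
    · intro m _
      constructor
      · intro h
        exact (List.cons.inj h).2
      · rintro rfl; rfl
  · apply MonoidAlgebra.coeff_single_mul_of_forall_mul_ne
    intro d hd
    exact h (List.cons.inj hd).1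

@[simp] lemma coeffAt_var_mul_nil (x : Letter) (P : NCPoly) : coeffAt (var x * P) [] = 0 := by
  unfold coeffAt var
  apply MonoidAlgebra.coeff_single_mul_of_forall_mul_ne
  intro d hd
  exact absurd hd (by exact List.cons_ne_nil x d)

open Classical in
lemma coeffAt_mul (P Q : NCPoly) (w : Word) :
    coeffAt (P * Q) w = ∑ u ∈ P.coeff.support, ∑ v ∈ Q.coeff.support,
      if u * v = FreeMonoid.ofList w then P.coeff u * Q.coeff v else 0 := by
  rw [coeffAt, MonoidAlgebra.coeff_mul]
  rfl

/-- All coefficients are nonnegative. -/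
def IsNonneg (P : NCPoly) : Prop := ∀ w, 0 ≤ coeffAt P w

lemma IsNonneg.mul {P Q : NCPoly} (hP : IsNonneg P) (hQ : IsNonneg Q) : IsNonneg (P * Q) := by
  intro w
  rw [coeffAt_mul]
  refine sum_nonneg fun u _ => sum_nonneg fun v _ => ?_
  split_ifs
  · exact mul_nonneg (hP _) (hQ _)
  · exact le_rfl

lemma isNonneg_one : IsNonneg 1 := fun w => by
  rw [coeffAt_one]; split_ifs <;> simp

lemma IsNonneg.pow {P : NCPoly} (hP : IsNonneg P) (k : ℕ) : IsNonneg (P ^ k) := by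
  induction k with
  | zero => simpa using isNonneg_one
  | succ k ih => rw [pow_succ]; exact ih.mul hP

lemma IsNonneg.sum {ι : Type*} {s : Finset ι} {f : ι → NCPoly}
    (h : ∀ i ∈ s, IsNonneg (f i)) : IsNonneg (∑ i ∈ s, f i) := fun w => by
  rw [coeffAt_sum]; exact sum_nonneg fun i hi => h i hi w

lemma IsNonneg.sub_one {P : NCPoly} (hP : IsNonneg P) (h1 : coeffAt P [] = 1) :
    IsNonneg (P - 1) := fun w => by
  rw [coeffAt_sub, coeffAt_one]
  split_ifs with h
  · subst h; simp [h1]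
  · simpa using hP w

/-- All words of length less than `m` have coefficient `0`. -/
def HasOrder (m : ℕ) (P : NCPoly) : Prop := ∀ w : Word, w.length < m → coeffAt P w = 0

lemma HasOrder.mul {j k : ℕ} {P Q : NCPoly} (hP : HasOrder j P) (hQ : HasOrder k Q) :
    HasOrder (j + k) (P * Q) := by
  intro w hw
  rw [coeffAt_mul]
  refine sum_eq_zero fun u _ => sum_eq_zero fun v _ => ?_
  split_ifs with h
  · have hl : (FreeMonoid.toList u).length + (FreeMonoid.toList v).length = w.length := by
      rw [← List.length_append, ← FreeMonoid.toList_mul, h, FreeMonoid.toList_ofList]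
    rcases lt_or_ge (FreeMonoid.toList u).length j with h1 | h1
    · have : P.coeff u = 0 := hP _ h1
      simp [this]
    · have : Q.coeff v = 0 := hQ (FreeMonoid.toList v) (by omega)
      simp [this]
  · rfl

lemma HasOrder.zero (P : NCPoly) : HasOrder 0 P := fun _ h => absurd h (Nat.not_lt_zero _)

lemma HasOrder.mono {j k : ℕ} (h : j ≤ k) {P : NCPoly} (hP : HasOrder k P) : HasOrder j P :=
  fun w hw => hP w (lt_of_lt_of_le hw h)

lemma HasOrder.pow {P : NCPoly} (hP : HasOrder 1 P) (k : ℕ) : HasOrder k (P ^ k) := by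
  induction k with
  | zero => exact HasOrder.zero _
  | succ k ih => rw [pow_succ]; exact ih.mul hP

lemma HasOrder.sub {m : ℕ} {P Q : NCPoly} (hP : HasOrder m P) (hQ : HasOrder m Q) :
    HasOrder m (P - Q) := fun w hw => by simp [hP w hw, hQ w hw]

lemma hasOrder_one_iff {P : NCPoly} : HasOrder 1 P ↔ coeffAt P [] = 0 := by
  constructor
  · intro h; exact h [] (by simp)
  · intro h w hw
    have : w = [] := by simpa using hw
    subst this; exact h

/-- In `Q = P Q - (P - 1) Q` the factor `P - 1` has no constant term, so each known order of `Q`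
improves by one, up to the order of `P Q`. -/
lemma HasOrder.of_mul_left {P Q : NCPoly} (hP : coeffAt P [] = 1) {m : ℕ}
    (h : HasOrder m (P * Q)) : HasOrder m Q := by
  have hP' : HasOrder 1 (P - 1) := hasOrder_one_iff.2 (by simp [hP, coeffAt_one])
  have key : ∀ k ≤ m, HasOrder k Q := by
    intro k
    induction k with
    | zero => intro _; exact HasOrder.zero _
    | succ k ih =>
      intro hk
      have h1 := hP'.mul (ih (by omega))
      rw [add_comm 1 k] at h1
      have : Q = P * Q - (P - 1) * Q := by noncomm_ring
      rw [this]
      exact (h.mono hk).sub h1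
  exact key m le_rfl

lemma coeffAt_nil_mul (P Q : NCPoly) : coeffAt (P * Q) [] = coeffAt P [] * coeffAt Q [] := by
  have h : ∀ R : NCPoly, HasOrder 1 (R - coeffAt R [] • 1) := fun R =>
    hasOrder_one_iff.2 (by rw [coeffAt_sub, coeffAt_smul, coeffAt_one]; simp)
  have h1 := hasOrder_one_iff.1 ((h P).mul (HasOrder.zero Q))
  have h2 : P * Q = (P - coeffAt P [] • 1) * Q + coeffAt P [] • Q := by
    rw [sub_mul, smul_mul_assoc, one_mul, sub_add_cancel]
  rw [h2, coeffAt_add, h1, coeffAt_smul, zero_add]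

end NCPoly

open NCPoly

/-- `A - 1`, for the alphabet `A = {a, b}`. -/
noncomputable abbrev alphSubOne : NCPoly := NCPoly.var Letter.a + NCPoly.var Letter.b - 1

lemma coeffAt_alphSubOne_nil : coeffAt alphSubOne [] = -1 := by
  have h : ∀ x, coeffAt (var x) [] = 0 := fun x => by simpa using coeffAt_var_mul_nil x 1
  simp [alphSubOne, h, coeffAt_one]

lemma coeffAt_alphSubOne_mul_cons (P : NCPoly) (x : Letter) (w : Word) :
    coeffAt (alphSubOne * P) (x :: w) = coeffAt P w - coeffAt P (x :: w) := by
  simp only [alphSubOne, sub_mul, add_mul, one_mul, coeffAt_sub, coeffAt_add,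
    coeffAt_var_mul_cons]
  cases x <;> simp

/-! ### Nonnegative factorizations yield finite maximal codes -/

/-- If `Q = P (A - 1) S + 1`, then `S (1 + Q + ⋯ + Q ^ N) P` agrees with the sum of all words up to
length `N`. -/
lemma coeffAt_mul_geom_mul {P S Q : NCPoly} (hQ : Q = P * alphSubOne * S + 1)
    (hP : coeffAt P [] = 1) (hS : coeffAt S [] = 1) (N : ℕ) (w : Word) (hw : w.length ≤ N) :
    coeffAt (S * (∑ k ∈ range (N + 1), Q ^ k) * P) w = 1 := by
  set X := S * (∑ k ∈ range (N + 1), Q ^ k) * P with hX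
  have hQ0 : coeffAt Q [] = 0 := by
    rw [hQ, coeffAt_add, coeffAt_nil_mul, coeffAt_nil_mul, hP, hS, coeffAt_alphSubOne_nil,
      coeffAt_one]
    simp
  -- Truncated form of `S Q^* P = A^*`: the geometric sum telescopes, and the remainder has order at
  -- least `N + 1` because `Q` has no constant term.
  have h1 : P * (alphSubOne * X + 1) = Q ^ (N + 1) * P := by
    have h2 : P * alphSubOne * S = Q - 1 := by rw [hQ]; abel
    have h3 : P * (alphSubOne * X + 1)
        = (P * alphSubOne * S) * (∑ k ∈ range (N + 1), Q ^ k) * P + P := by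
      rw [hX]; noncomm_ring
    rw [h3, h2, mul_geom_sum, sub_mul, one_mul, sub_add_cancel]
  have h2 : HasOrder (N + 1) (alphSubOne * X + 1) := by
    apply HasOrder.of_mul_left hP
    rw [h1]
    simpa using ((hasOrder_one_iff.2 hQ0).pow (N + 1)).mul (HasOrder.zero P)
  -- Up to length `N`, the vanishing of `(A - 1) X + 1` says that prepending a letter does not
  -- change the coefficient of `X`, starting from the value `1` at the empty word.
  induction w with
  | nil =>
    have := h2 [] (by simp)
    rw [coeffAt_add, coeffAt_nil_mul, coeffAt_alphSubOne_nil, coeffAt_one, if_pos rfl] at this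
    linarith
  | cons x w ih =>
    have h3 := h2 (x :: w) (by omega)
    rw [coeffAt_add, coeffAt_alphSubOne_mul_cons, coeffAt_one,
      ih (by simp at hw; omega)] at h3
    simp at h3
    linarith

lemma sum_coeffAt_pow_le_one {P S Q : NCPoly} (hQ : Q = P * alphSubOne * S + 1)
    (hPn : IsNonneg P) (hSn : IsNonneg S) (hQn : IsNonneg Q)
    (hP : coeffAt P [] = 1) (hS : coeffAt S [] = 1) (T : Finset ℕ) (w : Word) :
    ∑ k ∈ T, coeffAt (Q ^ k) w ≤ 1 := by
  set N := T.sup id + w.length with hN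
  have h := coeffAt_mul_geom_mul hQ hP hS N w (by omega)
  set G := ∑ k ∈ range (N + 1), Q ^ k with hG
  have hGn : IsNonneg G := IsNonneg.sum fun k _ => hQn.pow k
  -- The last two terms are nonnegative, so `G` is bounded by `S G P`, whose coefficient at `w` is
  -- `1`.
  have h1 : S * G * P = G + (S - 1) * G + S * G * (P - 1) := by noncomm_ring
  have h2 := ((hSn.sub_one hS).mul hGn) w
  have h3 := ((hSn.mul hGn).mul (hPn.sub_one hP)) w
  rw [h1, coeffAt_add, coeffAt_add] at h
  have h4 : coeffAt G w ≤ 1 := by linarith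
  rw [hG, coeffAt_sum] at h4
  refine le_trans (sum_le_sum_of_subset_of_nonneg ?_ fun k _ _ => hQn.pow k w) h4
  intro k hk
  have : k ≤ T.sup id := le_sup (f := id) hk
  simp only [mem_range]; omega

/-- The lists of `k` words from `C`. -/
def tuples (C : Finset Word) : ℕ → Finset (List Word)
  | 0 => {[]}
  | k + 1 => (C ×ˢ tuples C k).image fun x => x.1 :: x.2

lemma mem_tuples {C : Finset Word} {k : ℕ} {l : List Word} :
    l ∈ tuples C k ↔ l.length = k ∧ ∀ w ∈ l, w ∈ C := by
  induction k generalizing l with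
  | zero => simp +contextual [tuples, List.length_eq_zero_iff]
  | succ k ih =>
    cases l with
    | nil => simp [tuples]
    | cons x l => simp [tuples, ih]; tauto

lemma charPoly_pow (C : Finset Word) (k : ℕ) :
    charPoly C ^ k
      = ∑ l ∈ tuples C k, MonoidAlgebra.single (FreeMonoid.ofList l.flatten) (1 : ℤ) := by
  induction k with
  | zero => simp [tuples, MonoidAlgebra.one_def]
  | succ k ih =>
    rw [pow_succ', ih, tuples, sum_image, sum_product, charPoly, sum_mul_sum]
    · refine sum_congr rfl fun u _ => sum_congr rfl fun l _ => ?_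
      rw [MonoidAlgebra.single_mul_single]
      simp
    · rintro ⟨x, l⟩ _ ⟨y, m⟩ _ h
      simpa using h

lemma coeffAt_charPoly_pow (C : Finset Word) (k : ℕ) (w : Word) :
    coeffAt (charPoly C ^ k) w = ((tuples C k).filter fun l => l.flatten = w).card := by
  simp only [charPoly_pow, coeffAt_sum, coeffAt_single, card_filter, Nat.cast_sum, Nat.cast_ite,
    Nat.cast_one, Nat.cast_zero]

lemma coeffAt_charPoly (C : Finset Word) (w : Word) :
    coeffAt (charPoly C) w = if w ∈ C then 1 else 0 := by
  simp [charPoly, coeffAt_single]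

/-- The coefficient of `w` in the `k`-th power counts the factorizations of `w` into `k` words of
`C`. Factorizations of different lengths are caught by a two-element `T`. -/
lemma isCode_of_sum_coeffAt_pow_le_one {C : Finset Word}
    (h : ∀ (T : Finset ℕ) (w : Word), ∑ k ∈ T, coeffAt (charPoly C ^ k) w ≤ 1) :
    IsCode (C : Set Word) := by
  intro l₁ l₂ h₁ h₂ he
  have m₁ : l₁ ∈ (tuples C l₁.length).filter fun l => l.flatten = l₁.flatten :=
    mem_filter.2 ⟨mem_tuples.2 ⟨rfl, h₁⟩, rfl⟩
  have m₂ : l₂ ∈ (tuples C l₂.length).filter fun l => l.flatten = l₁.flatten :=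
    mem_filter.2 ⟨mem_tuples.2 ⟨rfl, h₂⟩, he.symm⟩
  by_cases hl : l₁.length = l₂.length
  · have := h {l₁.length} l₁.flatten
    rw [sum_singleton, coeffAt_charPoly_pow] at this
    exact card_le_one.1 (by exact_mod_cast this) _ m₁ _ (hl ▸ m₂)
  · have := h {l₁.length, l₂.length} l₁.flatten
    rw [sum_pair hl, coeffAt_charPoly_pow, coeffAt_charPoly_pow] at this
    have p₁ := card_pos.2 ⟨_, m₁⟩
    have p₂ := card_pos.2 ⟨_, m₂⟩
    omega

/-! ### Bernoulli measure and maximality -/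

instance : Fintype Letter := ⟨{Letter.a, Letter.b}, fun x => by cases x <;> simp⟩

lemma card_letter : Fintype.card Letter = 2 := rfl

/-- A finite code of full Bernoulli measure is maximal. -/
lemma isMaximalCode_of_sum_eq_one {C : Finset Word} (hC : IsCode (C : Set Word))
    (h : ∑ w ∈ C, (1 / 2 : ℝ) ^ w.length = 1) : IsMaximalCode (C : Set Word) := by
  refine ⟨hC, fun C' hC' hsub => Set.Subset.antisymm hsub fun x hx => ?_⟩
  by_contra hxC
  have hxC : x ∉ C := hxC
  have hcode : InformationTheory.UniquelyDecodable ((insert x C : Finset Word) : Set Word) := by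
    have hs : ((insert x C : Finset Word) : Set Word) ⊆ C' := by
      rw [coe_insert]; exact Set.insert_subset hx hsub
    exact fun l₁ l₂ h₁ h₂ he => hC' l₁ l₂ (fun w hw => hs (h₁ w hw)) (fun w hw => hs (h₂ w hw)) he
  have : Nonempty Letter := ⟨Letter.a⟩
  -- Adding `x` would raise the Kraft sum to `1 + 2^{-|x|}`, which exceeds `1`.
  have hk := InformationTheory.kraft_mcmillan_inequality hcode
  rw [card_letter, sum_insert hxC] at hk
  have hpos : (0 : ℝ) < (1 / 2) ^ x.length := by positivity
  push_cast at hk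
  linarith

/-- Evaluation of both letters at `1 / 2`. -/
noncomputable def evalHalf : NCPoly →ₐ[ℤ] ℝ :=
  MonoidAlgebra.lift ℤ ℝ (FreeMonoid Letter) (FreeMonoid.lift fun _ => (1 / 2 : ℝ))

lemma evalHalf_single (w : Word) :
    evalHalf (MonoidAlgebra.single (FreeMonoid.ofList w) 1) = (1 / 2 : ℝ) ^ w.length := by
  simp [evalHalf, MonoidAlgebra.lift_single, FreeMonoid.lift_apply]

lemma evalHalf_alphSubOne : evalHalf alphSubOne = 0 := by
  have h : ∀ x, evalHalf (var x) = 1 / 2 := fun x =>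
    (evalHalf_single [x]).trans (by simp)
  rw [alphSubOne, map_sub, map_add, h, h, map_one]; norm_num

/-- A nonnegative polynomial `P (A - 1) S + 1`, with `P` and `S` nonnegative of constant term `1`,
is the characteristic polynomial of a finite maximal code. -/
theorem exists_isMaximalCode {P S : NCPoly} (hPn : IsNonneg P) (hSn : IsNonneg S)
    (hQn : IsNonneg (P * alphSubOne * S + 1)) (hP : coeffAt P [] = 1) (hS : coeffAt S [] = 1) :
    ∃ C : Finset Word, IsMaximalCode (C : Set Word) ∧ charPoly C = P * alphSubOne * S + 1 := by
  set Q := P * alphSubOne * S + 1 with hQ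
  have hle := sum_coeffAt_pow_le_one hQ hPn hSn hQn hP hS
  let C : Finset Word := Q.coeff.support.image FreeMonoid.toList
  have hCQ : charPoly C = Q := by
    apply ext_coeffAt
    intro w
    -- The bound for the first power alone shows that `Q` has coefficients `0, 1`.
    have h1 := hle {1} w
    have h0 := hQn w
    have hmem : w ∈ C ↔ coeffAt Q w ≠ 0 := by
      simp only [C, mem_image, Finsupp.mem_support_iff]
      constructor
      · rintro ⟨u, hu, rfl⟩; exact hu
      · intro h; exact ⟨FreeMonoid.ofList w, h, rfl⟩
    rw [coeffAt_charPoly]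
    simp only [sum_singleton, pow_one] at h1
    split_ifs with h <;> rw [hmem] at h <;> omega
  refine ⟨C, isMaximalCode_of_sum_eq_one (isCode_of_sum_coeffAt_pow_le_one ?_) ?_, hCQ⟩
  · rw [hCQ]; exact hle
  · have h : evalHalf (charPoly C) = ∑ w ∈ C, (1 / 2 : ℝ) ^ w.length := by
      simp only [charPoly, map_sum, evalHalf_single]
    rw [← h, hCQ, hQ, map_add, map_mul, map_mul, evalHalf_alphSubOne]
    simp

end PosFact

namespace PosFact

open Finset Polynomial

/-! ### Krasner factorizations -/

lemma pPow_coeff (H : Finset ℕ) (k : ℕ) : (pPow H).coeff k = if k ∈ H then 1 else 0 := by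
  simp [pPow, powSet, finsetSum_coeff, coeff_X_pow]

lemma pPow_coeff_nonneg (H : Finset ℕ) (k : ℕ) : 0 ≤ (pPow H).coeff k := by
  rw [pPow_coeff]; split_ifs <;> simp

lemma pPow_coeff_le_one (H : Finset ℕ) (k : ℕ) : (pPow H).coeff k ≤ 1 := by
  rw [pPow_coeff]; split_ifs <;> simp

lemma coeff_mul_nonneg {f g : ℤ[X]} (hf : ∀ k, 0 ≤ f.coeff k) (hg : ∀ k, 0 ≤ g.coeff k) (k : ℕ) :
    0 ≤ (f * g).coeff k := by
  rw [coeff_mul]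
  exact sum_nonneg fun x _ => mul_nonneg (hf _) (hg _)

/-- `1 + X + ⋯ + X ^ (n - 1)`. -/
noncomputable abbrev geomPoly (n : ℕ) : ℤ[X] := ∑ k ∈ range n, (X : ℤ[X]) ^ k

lemma coeff_geomPoly_add_mul (n : ℕ) (W : ℤ[X]) (k : ℕ) :
    (geomPoly n + W * (X ^ n - 1)).coeff k
      = (if k < n then 1 else W.coeff (k - n)) - W.coeff k := by
  rw [mul_sub, mul_one, coeff_add, coeff_sub, coeff_mul_X_pow']
  simp only [geomPoly, finsetSum_coeff, coeff_X_pow, sum_ite_eq, mem_range]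
  split_ifs <;> omega

/-- The hypothesis reads `W_k ≤ 1` for `k < n` and `W_k ≤ W_{k-n}` for `k ≥ n`. Along each residue
class modulo `n` the coefficients descend from at most `1` to an eventual `0`. -/
lemma coeff_mem_of_geomPoly_add_mul_nonneg {n : ℕ} (hn : 0 < n) {W : ℤ[X]}
    (h : ∀ k, 0 ≤ (geomPoly n + W * (X ^ n - 1)).coeff k) (k : ℕ) :
    0 ≤ W.coeff k ∧ W.coeff k ≤ 1 := by
  simp only [coeff_geomPoly_add_mul] at h
  constructor
  · have h1 : ∀ t, W.coeff (k + t * n) ≤ W.coeff k := by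
      intro t
      induction t with
      | zero => simp
      | succ t ih =>
        have := h (k + (t + 1) * n)
        rw [if_neg (by nlinarith), show k + (t + 1) * n - n = k + t * n by
          rw [add_mul, one_mul]; omega] at this
        linarith
    have h2 := h1 (W.natDegree + 1)
    rwa [coeff_eq_zero_of_natDegree_lt (by nlinarith)] at h2
  · induction k using Nat.strong_induction_on with
    | _ k ih =>
      have := h k
      split_ifs at this with hk
      · linarith
      · have := ih (k - n) (by omega)
        linarith

namespace IsKrasner

variable {n : ℕ} {I J : Finset ℕ}

lemma symm (h : IsKrasner n I J) : IsKrasner n J I := ⟨h.1, by rw [mul_comm]; exact h.2⟩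

lemma mul_mul_X_sub_one (h : IsKrasner n I J) : pPow I * (X - 1) * pPow J = X ^ n - 1 := by
  rw [← geom_sum_mul, ← h.2]; ring

lemma zero_mem (h : IsKrasner n I J) : 0 ∈ I := by
  have h1 := congrArg (fun p => p.coeff 0) h.2
  simp only [mul_coeff_zero, pPow_coeff, finsetSum_coeff, coeff_X_pow, sum_ite_eq, mem_range,
    h.1, if_true] at h1
  by_contra h0
  simp [h0] at h1

/-- The coefficients of `a^I a^J` count representations as a sum, and none exceeds `1`. -/
lemma eq_of_add_eq (h : IsKrasner n I J) {i i' j j' : ℕ} (hi : i ∈ I) (hi' : i' ∈ I)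
    (hj : j ∈ J) (hj' : j' ∈ J) (he : i + j = i' + j') : i = i' := by
  have h1 := congrArg (fun p => p.coeff (i + j)) h.2
  have h2 : pPow I * pPow J = ∑ x ∈ I ×ˢ J, (X : ℤ[X]) ^ (x.1 + x.2) := by
    simp only [pPow, powSet, sum_mul_sum, sum_product, pow_add]
  rw [h2] at h1
  simp only [finsetSum_coeff, coeff_X_pow, sum_ite_eq] at h1
  have h3 : (((I ×ˢ J).filter fun x => i + j = x.1 + x.2).card : ℤ) ≤ 1 := by
    rw [card_filter]
    push_cast
    rw [h1]
    split_ifs <;> simp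
  have h4 := card_le_one.1 (by exact_mod_cast h3) (i, j) (by simp [hi, hj]) (i', j')
    (by simp [hi', hj', he])
  exact congrArg Prod.fst h4

lemma lt_of_mem (h : IsKrasner n I J) {i : ℕ} (hi : i ∈ I) : i < n := by
  by_contra hin
  have h1 := congrArg (fun p => p.coeff i) h.2
  simp only [finsetSum_coeff, coeff_X_pow, sum_ite_eq, mem_range, if_neg hin] at h1
  rw [coeff_mul] at h1
  have h2 := (sum_eq_zero_iff_of_nonneg (fun x _ => mul_nonneg (pPow_coeff_nonneg I _)
    (pPow_coeff_nonneg J _))).1 h1 (i, 0) (by simp)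
  simp [pPow_coeff, hi, h.symm.zero_mem] at h2

lemma mul_hajos (h : IsKrasner n I J) (L : Finset ℕ) :
    pPow I * hajos L J = geomPoly n + pPow L * (X ^ n - 1) := by
  rw [← h.mul_mul_X_sub_one, geomPoly, ← h.2, hajos]; ring

/-- Multiplication by `a^I` gives a polynomial with coefficients at most `1`, and it dominates the
original because `0 ∈ I`. Thus the multiset `R` is a set. -/
lemma coeff_hajos_le_one (h : IsKrasner n I J) {L : Finset ℕ}
    (hL : ∀ k, 0 ≤ (hajos L J).coeff k) (k : ℕ) : (hajos L J).coeff k ≤ 1 := by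
  have h1 := congrArg (fun p => p.coeff k) (h.mul_hajos L)
  simp only [coeff_geomPoly_add_mul] at h1
  have h2 : (hajos L J).coeff k ≤ (pPow I * hajos L J).coeff k := by
    rw [coeff_mul]
    have := single_le_sum (f := fun x : ℕ × ℕ => (pPow I).coeff x.1 * (hajos L J).coeff x.2)
      (fun x _ => mul_nonneg (pPow_coeff_nonneg I _) (hL _))
      (show (0, k) ∈ antidiagonal k by simp)
    simpa [pPow_coeff, h.zero_mem] using this
  have h3 := pPow_coeff_nonneg L k
  have h4 := pPow_coeff_le_one L (k - n)
  split_ifs at h1 <;> linarith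

/-- If `a^L (a - 1) a^J + a^J` and `a^M (a - 1) a^I + a^I` are nonnegative, then
`a^L (a - 1) a^M + a^L + a^M` has coefficients `0` and `1`. -/
lemma coeff_hajos_add_mem (h : IsKrasner n I J) {L M : Finset ℕ}
    (hL : ∀ k, 0 ≤ (hajos L J).coeff k) (hM : ∀ k, 0 ≤ (hajos M I).coeff k) (k : ℕ) :
    0 ≤ (hajos L M).coeff k + (pPow L).coeff k ∧
      (hajos L M).coeff k + (pPow L).coeff k ≤ 1 := by
  rw [← coeff_add]
  refine coeff_mem_of_geomPoly_add_mul_nonneg h.1 ?_ k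
  -- Each factor on the right splits as `a^J (1 + a^L (a - 1))`, respectively `a^I (1 + a^M (a -
  -- 1))`, and `a^I a^J (a - 1) = a^n - 1`.
  have h1 : geomPoly n + (hajos L M + pPow L) * (X ^ n - 1) = hajos L J * hajos M I := by
    rw [← h.mul_mul_X_sub_one, geomPoly, ← h.2]
    simp only [hajos]; ring
  rw [h1]
  exact coeff_mul_nonneg hL hM

/-- Multiplying by `a^J` turns the second term into `N (a^n - 1)`. At `p ∈ I` one has `p < n`, and
`p = p + 0` is the only decomposition in `I + J`, so the coefficient is `c p - N_p`. -/
lemma nonneg_of_sum_add_nonneg (h : IsKrasner n I J) (c : ℕ → ℤ) (N : ℤ[X])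
    (hN : ∀ k, 0 ≤ N.coeff k)
    (hc : ∀ p, 0 ≤ (if p ∈ I then c p else 0) + (pPow I * (X - 1) * N).coeff p) {p : ℕ}
    (hp : p ∈ I) : 0 ≤ c p := by
  set D : ℤ[X] := ∑ i ∈ I, C (c i) * X ^ i with hD
  have hDc : ∀ k, D.coeff k = if k ∈ I then c k else 0 := by
    intro k
    simp [hD, finsetSum_coeff, coeff_X_pow]
  have h1 : (pPow J * (D + pPow I * (X - 1) * N)) = D * pPow J + N * X ^ n - N := by
    have := h.mul_mul_X_sub_one
    linear_combination N * this
  have h2 := coeff_mul_nonneg (pPow_coeff_nonneg J) (g := D + pPow I * (X - 1) * N)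
    (fun k => by rw [coeff_add, hDc]; exact hc k) p
  rw [h1, coeff_sub, coeff_add, coeff_mul_X_pow', if_neg (not_le.2 (h.lt_of_mem hp))] at h2
  have h3 : (D * pPow J).coeff p = c p := by
    rw [coeff_mul, sum_eq_single (p, 0)]
    · simp [hDc, hp, pPow_coeff, h.symm.zero_mem]
    · rintro ⟨i, j⟩ hij hne
      rw [HasAntidiagonal.mem_antidiagonal] at hij
      simp only at hij
      rw [hDc, pPow_coeff]
      by_cases hi : i ∈ I
      · by_cases hj : j ∈ J
        · have := h.eq_of_add_eq hi hp hj h.symm.zero_mem (by simpa using hij)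
          exact absurd (Prod.ext this (by simp; omega)) hne
        · simp [hj]
      · simp [hi]
    · simp
  have := hN p
  rw [h3] at h2
  linarith

/-- Otherwise multiplication by `a^I` gives `a^H (a^n - 1)`, with coefficient `-1` at the least
element of `H`. -/
lemma eq_empty_of_nonneg (h : IsKrasner n I J) {H : Finset ℕ}
    (hH : ∀ k, 0 ≤ (pPow H * (X - 1) * pPow J).coeff k) : H = ∅ := by
  by_contra hne
  obtain ⟨m, hm, hmin⟩ := H.exists_min_image id (Finset.nonempty_iff_ne_empty.2 hne)
  have h1 := coeff_mul_nonneg (pPow_coeff_nonneg I) hH m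
  rw [show pPow I * (pPow H * (X - 1) * pPow J) = pPow H * X ^ n - pPow H by
    linear_combination pPow H * h.mul_mul_X_sub_one, coeff_sub, coeff_mul_X_pow', pPow_coeff,
    pPow_coeff, if_pos hm] at h1
  have h2 : m - n ∈ H → m ≤ m - n := hmin (m - n)
  have := h.1
  split_ifs at h1 with h3 h4
  · have := h2 h4; omega
  all_goals omega

end IsKrasner

end PosFact

namespace PosFact

open Finset NCPoly
open Polynomial (X)

/-! ### Coefficients of products `f(a) b R` -/

/-- The word `a ^ p`. -/
abbrev aWord (p : ℕ) : Word := List.replicate p Letter.a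

/-- The word `a ^ p b w`. -/
abbrev abWord (p : ℕ) (w : Word) : Word := aWord p ++ Letter.b :: w

lemma aWord_or_abWord (w : Word) : (∃ p, w = aWord p) ∨ ∃ p v, w = abWord p v := by
  induction w with
  | nil => exact Or.inl ⟨0, rfl⟩
  | cons x w ih =>
    cases x with
    | b => exact Or.inr ⟨0, w, rfl⟩
    | a =>
      rcases ih with ⟨p, rfl⟩ | ⟨p, v, rfl⟩
      · exact Or.inl ⟨p + 1, rfl⟩
      · exact Or.inr ⟨p + 1, v, rfl⟩

/-- The polynomial `f` in the letter `a`, as an element of `ℤ⟨A⟩`. -/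
noncomputable abbrev ofPoly : ℤ[X] →ₐ[ℤ] NCPoly := Polynomial.aeval (NCPoly.var Letter.a)

lemma ofPoly_pPow (H : Finset ℕ) : ofPoly (pPow H) = aPow H := by
  simp [pPow, aPow, powSet]

lemma coeffAt_var_pow_mul_b_abWord (k p : ℕ) (R : NCPoly) (w : Word) :
    coeffAt (var Letter.a ^ k * (bVar * R)) (abWord p w) = if k = p then coeffAt R w else 0 := by
  induction k generalizing p with
  | zero =>
    cases p with
    | zero => simp [abWord, aWord, bVar, coeffAt_var_mul_cons]
    | succ p => simp [abWord, aWord, bVar, List.replicate_succ, coeffAt_var_mul_cons]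
  | succ k ih =>
    rw [pow_succ', mul_assoc]
    cases p with
    | zero => simp [abWord, aWord, coeffAt_var_mul_cons]
    | succ p =>
      rw [abWord, aWord, List.replicate_succ, List.cons_append, coeffAt_var_mul_cons, if_pos rfl,
        ih]
      simp

lemma coeffAt_var_pow_mul_b_aWord (k p : ℕ) (R : NCPoly) :
    coeffAt (var Letter.a ^ k * (bVar * R)) (aWord p) = 0 := by
  induction k generalizing p with
  | zero =>
    cases p with
    | zero => simp [aWord, bVar]
    | succ p => simp [aWord, bVar, List.replicate_succ, coeffAt_var_mul_cons]
  | succ k ih =>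
    rw [pow_succ', mul_assoc]
    cases p with
    | zero => simp [aWord]
    | succ p => simp [aWord, List.replicate_succ, coeffAt_var_mul_cons, ih]

lemma coeffAt_var_pow_aWord (k p : ℕ) :
    coeffAt (var Letter.a ^ k) (aWord p) = if k = p then 1 else 0 := by
  induction k generalizing p with
  | zero => cases p <;> simp [coeffAt_one, aWord, List.replicate_succ]
  | succ k ih =>
    rw [pow_succ']
    cases p with
    | zero => simp [aWord]
    | succ p => rw [aWord, List.replicate_succ, coeffAt_var_mul_cons, if_pos rfl, ih]; simp

lemma coeffAt_var_pow_abWord (k p : ℕ) (w : Word) :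
    coeffAt (var Letter.a ^ k) (abWord p w) = 0 := by
  induction k generalizing p with
  | zero => cases p <;> simp [coeffAt_one, abWord, aWord]
  | succ k ih =>
    rw [pow_succ']
    cases p with
    | zero => simp [abWord, aWord, coeffAt_var_mul_cons]
    | succ p =>
      rw [abWord, aWord, List.replicate_succ, List.cons_append, coeffAt_var_mul_cons, if_pos rfl,
        ih]

lemma coeffAt_ofPoly_mul (f : ℤ[X]) (R : NCPoly) (w : Word) :
    coeffAt (ofPoly f * R) w
      = ∑ k ∈ range (f.natDegree + 1), f.coeff k * coeffAt (var Letter.a ^ k * R) w := by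
  rw [ofPoly, Polynomial.aeval_eq_sum_range, sum_mul, coeffAt_sum]
  simp only [smul_mul_assoc, coeffAt_smul]

lemma sum_range_coeff_mul_ite (f : ℤ[X]) (p : ℕ) (c : ℤ) :
    ∑ k ∈ range (f.natDegree + 1), f.coeff k * (if k = p then c else 0) = f.coeff p * c := by
  simp only [mul_ite, mul_zero, sum_ite_eq', mem_range]
  split_ifs with h
  · rfl
  · rw [Polynomial.coeff_eq_zero_of_natDegree_lt (by omega), zero_mul]

lemma coeffAt_ofPoly_mul_b_abWord (f : ℤ[X]) (R : NCPoly) (p : ℕ) (w : Word) :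
    coeffAt (ofPoly f * (bVar * R)) (abWord p w) = f.coeff p * coeffAt R w := by
  simp only [coeffAt_ofPoly_mul, coeffAt_var_pow_mul_b_abWord, sum_range_coeff_mul_ite]

lemma coeffAt_ofPoly_mul_b_aWord (f : ℤ[X]) (R : NCPoly) (p : ℕ) :
    coeffAt (ofPoly f * (bVar * R)) (aWord p) = 0 := by
  simp only [coeffAt_ofPoly_mul, coeffAt_var_pow_mul_b_aWord, mul_zero, sum_const_zero]

lemma coeffAt_ofPoly_aWord (f : ℤ[X]) (p : ℕ) : coeffAt (ofPoly f) (aWord p) = f.coeff p := by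
  have h := coeffAt_ofPoly_mul f 1 (aWord p)
  simpa only [mul_one, coeffAt_var_pow_aWord, sum_range_coeff_mul_ite] using h

lemma coeffAt_ofPoly_abWord (f : ℤ[X]) (p : ℕ) (w : Word) :
    coeffAt (ofPoly f) (abWord p w) = 0 := by
  have h := coeffAt_ofPoly_mul f 1 (abWord p w)
  simpa only [mul_one, coeffAt_var_pow_abWord, mul_zero, sum_const_zero] using h

lemma coeffAt_aPow_aWord (H : Finset ℕ) (p : ℕ) :
    coeffAt (aPow H) (aWord p) = if p ∈ H then 1 else 0 := by
  rw [← ofPoly_pPow, coeffAt_ofPoly_aWord, pPow_coeff]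

lemma coeffAt_aPow_abWord (H : Finset ℕ) (p : ℕ) (w : Word) :
    coeffAt (aPow H) (abWord p w) = 0 := by
  rw [← ofPoly_pPow, coeffAt_ofPoly_abWord]

/-! ### The coefficients of `P`, `S` and `P (A - 1) S` -/

/-- `a^H + ∑_{i ∈ s} a^i b Q_i`. -/
noncomputable def branch (H s : Finset ℕ) (Q : ℕ → NCPoly) : NCPoly :=
  aPow H + ∑ i ∈ s, aPow {i} * (bVar * Q i)

/-- Nesting `branch` lets a single coefficient recursion, peeling off one `b` at a time, treat every
level of `P`. -/
lemma polyP_eq_branch (I : Finset ℕ) (L : ℕ → Finset ℕ) (L₂ : ℕ → ℕ → Finset ℕ) :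
    polyP I L L₂ = branch I I fun i => branch (L i) (L i) fun l => aPow (L₂ i l) := by
  simp only [polyP, branch, mul_add, mul_sum, sum_add_distrib, mul_assoc, add_assoc]

lemma aPow_eq_branch (H : Finset ℕ) : aPow H = branch H ∅ 0 := by simp [branch]

section branch

variable (H s : Finset ℕ) (Q : ℕ → NCPoly)

lemma coeffAt_sum_aPow_mul_b_abWord (p : ℕ) (w : Word) :
    coeffAt (∑ i ∈ s, aPow {i} * (bVar * Q i)) (abWord p w)
      = if p ∈ s then coeffAt (Q p) w else 0 := by
  simp [← ofPoly_pPow, coeffAt_ofPoly_mul_b_abWord, pPow_coeff]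

lemma coeffAt_sum_aPow_mul_b_aWord (p : ℕ) :
    coeffAt (∑ i ∈ s, aPow {i} * (bVar * Q i)) (aWord p) = 0 := by
  simp only [← ofPoly_pPow, coeffAt_sum, coeffAt_ofPoly_mul_b_aWord, sum_const_zero]

lemma coeffAt_branch_aWord (p : ℕ) :
    coeffAt (branch H s Q) (aWord p) = if p ∈ H then 1 else 0 := by
  rw [branch, coeffAt_add, coeffAt_sum_aPow_mul_b_aWord, coeffAt_aPow_aWord, add_zero]

lemma coeffAt_branch_abWord (p : ℕ) (w : Word) :
    coeffAt (branch H s Q) (abWord p w) = if p ∈ s then coeffAt (Q p) w else 0 := by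
  rw [branch, coeffAt_add, coeffAt_sum_aPow_mul_b_abWord, coeffAt_aPow_abWord, zero_add]

lemma isZeroOne_branch (h : ∀ i ∈ s, (Q i).IsZeroOne) : (branch H s Q).IsZeroOne := by
  intro w
  rcases aWord_or_abWord w with ⟨p, rfl⟩ | ⟨p, v, rfl⟩
  · rw [coeffAt_branch_aWord]; split_ifs <;> simp
  · rw [coeffAt_branch_abWord]
    split_ifs with hp
    · exact h p hp v
    · simp

end branch

lemma isZeroOne_aPow (H : Finset ℕ) : (aPow H).IsZeroOne := by
  rw [aPow_eq_branch]; exact isZeroOne_branch _ _ _ (by simp)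

lemma isZeroOne_polyP (I : Finset ℕ) (L : ℕ → Finset ℕ) (L₂ : ℕ → ℕ → Finset ℕ) :
    (polyP I L L₂).IsZeroOne := by
  rw [polyP_eq_branch]
  exact isZeroOne_branch _ _ _ fun _ _ => isZeroOne_branch _ _ _ fun _ _ => isZeroOne_aPow _

section polyS

variable (J J' : Finset ℕ) (M : ℕ → Finset ℕ)

lemma sum_mul_coeffAt_aPow_aWord (g : ℕ → ℤ) (q : ℕ) :
    ∑ j ∈ J', g j * coeffAt (aPow {j}) (aWord q) = if q ∈ J' then g q else 0 := by
  simp [coeffAt_aPow_aWord]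

lemma sum_mul_coeffAt_aPow_abWord (g : ℕ → ℤ) (q : ℕ) (w : Word) :
    ∑ j ∈ J', g j * coeffAt (aPow {j}) (abWord q w) = 0 := by
  simp [coeffAt_aPow_abWord]

lemma ofPoly_mul_polyS (f : ℤ[X]) : ofPoly f * polyS J J' M
    = ofPoly (f * pPow J) + ∑ j ∈ J', ofPoly (f * pPow (M j)) * (bVar * aPow {j}) := by
  simp only [polyS, mul_add, mul_sum, map_mul, ofPoly_pPow, mul_assoc]

lemma coeffAt_ofPoly_mul_polyS_aWord (f : ℤ[X]) (p : ℕ) :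
    coeffAt (ofPoly f * polyS J J' M) (aWord p) = (f * pPow J).coeff p := by
  rw [ofPoly_mul_polyS, coeffAt_add, coeffAt_sum, coeffAt_ofPoly_aWord]
  simp only [coeffAt_ofPoly_mul_b_aWord, sum_const_zero, add_zero]

lemma coeffAt_ofPoly_mul_polyS_abWord (f : ℤ[X]) (p : ℕ) (w : Word) :
    coeffAt (ofPoly f * polyS J J' M) (abWord p w)
      = ∑ j ∈ J', (f * pPow (M j)).coeff p * coeffAt (aPow {j}) w := by
  rw [ofPoly_mul_polyS, coeffAt_add, coeffAt_sum, coeffAt_ofPoly_abWord, zero_add]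
  simp only [coeffAt_ofPoly_mul_b_abWord]

lemma coeffAt_polyS_aWord (q : ℕ) :
    coeffAt (polyS J J' M) (aWord q) = if q ∈ J then 1 else 0 := by
  simpa [pPow_coeff] using coeffAt_ofPoly_mul_polyS_aWord J J' M 1 q

lemma coeffAt_polyS_abWord (p : ℕ) (w : Word) :
    coeffAt (polyS J J' M) (abWord p w)
      = ∑ j ∈ J', (pPow (M j)).coeff p * coeffAt (aPow {j}) w := by
  simpa using coeffAt_ofPoly_mul_polyS_abWord J J' M 1 p w

lemma isZeroOne_polyS : (polyS J J' M).IsZeroOne := by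
  intro w
  rcases aWord_or_abWord w with ⟨p, rfl⟩ | ⟨p, v, rfl⟩
  · rw [coeffAt_polyS_aWord]; split_ifs <;> simp
  · rw [coeffAt_polyS_abWord]
    rcases aWord_or_abWord v with ⟨q, rfl⟩ | ⟨q, v, rfl⟩
    · rw [sum_mul_coeffAt_aPow_aWord, pPow_coeff]; split_ifs <;> simp
    · rw [sum_mul_coeffAt_aPow_abWord]; simp

variable (H s : Finset ℕ) (Q : ℕ → NCPoly)

/-- Writing `A - 1 = (a - 1) + b` sorts the product by the origin of the first `b`: the factor `S`
(or no `b` at all), the alphabet, or the left factor. -/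
lemma branch_mul : branch H s Q * (alphSubOne * polyS J J' M)
    = ofPoly (pPow H * (X - 1)) * polyS J J' M + ofPoly (pPow H) * (bVar * polyS J J' M)
      + ∑ i ∈ s, aPow {i} * (bVar * (Q i * (alphSubOne * polyS J J' M))) := by
  have h : alphSubOne = ofPoly (X - 1) + bVar := by
    simp only [alphSubOne, bVar, map_sub, map_one, Polynomial.aeval_X]; abel
  rw [branch, add_mul, sum_mul]
  congr 1
  · rw [h, ← ofPoly_pPow, map_mul]; noncomm_ring
  · simp only [mul_assoc]

lemma coeffAt_branch_mul_aWord (p : ℕ) :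
    coeffAt (branch H s Q * (alphSubOne * polyS J J' M)) (aWord p)
      = (pPow H * (X - 1) * pPow J).coeff p := by
  rw [branch_mul, coeffAt_add, coeffAt_add, coeffAt_sum_aPow_mul_b_aWord,
    coeffAt_ofPoly_mul_polyS_aWord, coeffAt_ofPoly_mul_b_aWord, add_zero, add_zero]

lemma coeffAt_branch_mul_abWord (p : ℕ) (w : Word) :
    coeffAt (branch H s Q * (alphSubOne * polyS J J' M)) (abWord p w)
      = ∑ j ∈ J', (pPow H * (X - 1) * pPow (M j)).coeff p * coeffAt (aPow {j}) w
        + (pPow H).coeff p * coeffAt (polyS J J' M) w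
        + if p ∈ s then coeffAt (Q p * (alphSubOne * polyS J J' M)) w else 0 := by
  rw [branch_mul, coeffAt_add, coeffAt_add, coeffAt_sum_aPow_mul_b_abWord,
    coeffAt_ofPoly_mul_polyS_abWord, coeffAt_ofPoly_mul_b_abWord]

end polyS

lemma coeffAt_one_abWord (p : ℕ) (w : Word) : coeffAt 1 (abWord p w) = 0 := by
  simp [coeffAt_one]

/-- Nonnegativity of `P (A - 1) S + 1`, word by word. -/
lemma isNonneg_iff {n : ℕ} {I J : Finset ℕ} (h : IsKrasner n I J) (J' : Finset ℕ)
    (L M : ℕ → Finset ℕ) (L₂ : ℕ → ℕ → Finset ℕ) :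
    IsNonneg (polyP I L L₂ * alphSubOne * polyS J J' M + 1) ↔
      (∀ p q, 0 ≤ (if p ∈ I then (hajos (L p) J).coeff q else 0)
        + (if q ∈ J' then (pPow I * (X - 1) * pPow (M q)).coeff p else 0)) ∧
      (∀ p ∈ I, ∀ m q, 0 ≤ (if q ∈ J' then (hajos (L p) (M q)).coeff m else 0)
        + (if m ∈ L p then (hajos (L₂ p m) J).coeff q else 0)) ∧
      (∀ p ∈ I, ∀ m ∈ L p, ∀ r q, 0 ≤ (if q ∈ J' then (hajos (L₂ p m) (M q)).coeff r else 0)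
        + (if q ∈ J then (pPow (L₂ p m)).coeff r else 0)) := by
  set Z := polyP I L L₂ * alphSubOne * polyS J J' M + 1 with hZ
  rw [polyP_eq_branch, mul_assoc] at hZ
  -- Without `b` the product contributes `a^n - 1`, so `Z` contributes `a^n`.
  have e0 : ∀ p, 0 ≤ coeffAt Z (aWord p) := by
    intro p
    rw [hZ, coeffAt_add, coeffAt_branch_mul_aWord, h.mul_mul_X_sub_one, coeffAt_one]
    rw [Polynomial.coeff_sub, Polynomial.coeff_X_pow, Polynomial.coeff_one]
    cases p <;> split_ifs <;> simp_all
  have e1 : ∀ p q, coeffAt Z (abWord p (aWord q))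
      = (if p ∈ I then (hajos (L p) J).coeff q else 0)
        + (if q ∈ J' then (pPow I * (X - 1) * pPow (M q)).coeff p else 0) := by
    intro p q
    rw [hZ, coeffAt_add, coeffAt_one_abWord, coeffAt_branch_mul_abWord,
      sum_mul_coeffAt_aPow_aWord, coeffAt_polyS_aWord, coeffAt_branch_mul_aWord, hajos,
      Polynomial.coeff_add, pPow_coeff, pPow_coeff]
    split_ifs <;> ring
  have e2 : ∀ p m q, coeffAt Z (abWord p (abWord m (aWord q)))
      = if p ∈ I then (if q ∈ J' then (hajos (L p) (M q)).coeff m else 0)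
        + (if m ∈ L p then (hajos (L₂ p m) J).coeff q else 0) else 0 := by
    intro p m q
    rw [hZ, coeffAt_add, coeffAt_one_abWord, coeffAt_branch_mul_abWord,
      sum_mul_coeffAt_aPow_abWord, coeffAt_polyS_abWord, sum_mul_coeffAt_aPow_aWord,
      coeffAt_branch_mul_abWord, sum_mul_coeffAt_aPow_aWord, coeffAt_polyS_aWord,
      aPow_eq_branch, coeffAt_branch_mul_aWord, hajos, hajos, Polynomial.coeff_add,
      Polynomial.coeff_add, pPow_coeff I, pPow_coeff J, pPow_coeff (L p)]
    split_ifs <;> ring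
  have e3 : ∀ p m r w, coeffAt Z (abWord p (abWord m (abWord r w)))
      = if p ∈ I then if m ∈ L p then
          ∑ j ∈ J', (hajos (L₂ p m) (M j)).coeff r * coeffAt (aPow {j}) w
            + (pPow (L₂ p m)).coeff r * coeffAt (polyS J J' M) w else 0 else 0 := by
    intro p m r w
    rw [hZ, coeffAt_add, coeffAt_one_abWord, coeffAt_branch_mul_abWord,
      sum_mul_coeffAt_aPow_abWord, coeffAt_polyS_abWord, sum_mul_coeffAt_aPow_abWord,
      coeffAt_branch_mul_abWord, sum_mul_coeffAt_aPow_abWord, coeffAt_polyS_abWord,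
      aPow_eq_branch, coeffAt_branch_mul_abWord, pPow_coeff I, pPow_coeff (L p)]
    simp only [hajos, Polynomial.coeff_add, add_mul, sum_add_distrib, notMem_empty, if_false]
    split_ifs <;> ring
  have e3a : ∀ p m r q, coeffAt Z (abWord p (abWord m (abWord r (aWord q))))
      = if p ∈ I then if m ∈ L p then (if q ∈ J' then (hajos (L₂ p m) (M q)).coeff r else 0)
        + (if q ∈ J then (pPow (L₂ p m)).coeff r else 0) else 0 else 0 := by
    intro p m r q
    rw [e3, sum_mul_coeffAt_aPow_aWord, coeffAt_polyS_aWord, mul_ite, mul_one, mul_zero]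
  -- With at least four `b`'s, the third must come from the alphabet, leaving a product of
  -- coefficients of `a^{L_{i,ℓ}}` and `S`.
  have e3b : ∀ p m r s w, 0 ≤ coeffAt Z (abWord p (abWord m (abWord r (abWord s w)))) := by
    intro p m r s w
    rw [e3, sum_mul_coeffAt_aPow_abWord, zero_add]
    have := mul_nonneg (pPow_coeff_nonneg (L₂ p m) r)
      ((isZeroOne_polyS J J' M (abWord s w)).elim ge_of_eq fun h => h ▸ zero_le_one)
    split_ifs <;> first | exact this | exact le_rfl
  constructor
  · intro hnn
    refine ⟨fun p q => e1 p q ▸ hnn _, fun p hp m q => ?_, fun p hp m hm r q => ?_⟩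
    · simpa only [e2, if_pos hp] using hnn (abWord p (abWord m (aWord q)))
    · simpa only [e3a, if_pos hp, if_pos hm] using
        hnn (abWord p (abWord m (abWord r (aWord q))))
  · rintro ⟨h1, h2, h3⟩ w
    rcases aWord_or_abWord w with ⟨p, rfl⟩ | ⟨p, w, rfl⟩
    · exact e0 p
    rcases aWord_or_abWord w with ⟨q, rfl⟩ | ⟨m, w, rfl⟩
    · rw [e1]; exact h1 p q
    rcases aWord_or_abWord w with ⟨q, rfl⟩ | ⟨r, w, rfl⟩
    · rw [e2]
      by_cases hp : p ∈ I
      · rw [if_pos hp]; exact h2 p hp m q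
      · rw [if_neg hp]
    rcases aWord_or_abWord w with ⟨q, rfl⟩ | ⟨s, w, rfl⟩
    · rw [e3a]
      by_cases hp : p ∈ I
      · rw [if_pos hp]
        by_cases hm : m ∈ L p
        · rw [if_pos hm]; exact h3 p hp m hm r q
        · rw [if_neg hm]
      · rw [if_neg hp]
    · exact e3b p m r s w

lemma exists_positiveFactorization_iff {n : ℕ} {I J : Finset ℕ} (h : IsKrasner n I J)
    (J' : Finset ℕ) (L M : ℕ → Finset ℕ) (L₂ : ℕ → ℕ → Finset ℕ) :
    (∃ C : Finset Word, IsMaximalCode (C : Set Word) ∧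
        IsPositiveFactorization (polyP I L L₂) (polyS J J' M) C) ↔
      IsNonneg (polyP I L L₂ * alphSubOne * polyS J J' M + 1) := by
  have hP := isZeroOne_polyP I L L₂
  have hS := isZeroOne_polyS J J' M
  constructor
  · rintro ⟨C, -, hC, -⟩ w
    have hC : charPoly C = polyP I L L₂ * alphSubOne * polyS J J' M + 1 := hC
    rw [← hC, coeffAt_charPoly]
    split_ifs <;> simp
  · intro hnn
    have hn : ∀ {R : NCPoly}, R.IsZeroOne → IsNonneg R := fun hR w =>
      (hR w).elim ge_of_eq fun h => h ▸ zero_le_one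
    obtain ⟨C, hC, he⟩ := exists_isMaximalCode (hn hP) (hn hS) hnn
      (by
        rw [polyP_eq_branch]
        exact (coeffAt_branch_aWord _ _ _ 0).trans (if_pos h.zero_mem))
      ((coeffAt_polyS_aWord J J' M 0).trans (if_pos h.symm.zero_mem))
    exact ⟨C, hC, he, Or.inl ⟨hP, hS⟩⟩

end PosFact

/-! ### From word-by-word nonnegativity to the seven conditions -/

namespace PosFact

open Polynomial (X)

lemma coeffLE_zero_iff {p : ℤ[X]} : CoeffLE 0 p ↔ ∀ k, 0 ≤ p.coeff k := by simp [CoeffLE]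

lemma mem_expSet {L J : Finset ℕ} {j : ℕ} : j ∈ expSet L J ↔ (hajos L J).coeff j ≠ 0 :=
  Polynomial.mem_support_iff

/-- As the `a^{R_i}` have coefficients `0, 1`, membership of `j` in `R_i` is the coefficient itself.
This identifies the one-`b` inequality with condition 5. -/
lemma IsKrasner.coeff_pPow_filter_expSet {n : ℕ} {I J : Finset ℕ} (h : IsKrasner n I J)
    {L : ℕ → Finset ℕ} (hL : ∀ i ∈ I, ∀ k, 0 ≤ (hajos (L i) J).coeff k) (j p : ℕ) :
    (pPow (I.filter fun i => j ∈ expSet (L i) J)).coeff p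
      = if p ∈ I then (hajos (L p) J).coeff j else 0 := by
  rw [pPow_coeff]
  simp only [Finset.mem_filter, mem_expSet]
  by_cases hp : p ∈ I
  · have h0 := hL p hp j
    have h1 := h.coeff_hajos_le_one (hL p hp) j
    simp only [hp, true_and, if_true]
    split_ifs <;> omega
  · simp [hp]

lemma coeffLE_hajos_of_subset {H I I' : Finset ℕ} (hI : I' ⊆ I) :
    CoeffLE (pPow H * (X - 1) * pPow I + pPow I') (hajos H I) := by
  intro k
  rw [hajos, Polynomial.coeff_add, Polynomial.coeff_add, pPow_coeff I', pPow_coeff I]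
  have := @hI k
  split_ifs <;> simp_all

end PosFact

open PosFact in
/-- The conditions on the right-hand side are, in order: the two conditions relating the
`L_{i,ℓ}` and the `M_j`; the three conditions relating the `L_i` and the `M_j`, where
`R_i = expSet (L i) J` and `I_j = {i ∈ I | j ∈ R_i}`; and the two further conditions,
where `R_{i,ℓ} = expSet (L₂ i ℓ) J`. -/
theorem mainTheorem7 (n : ℕ) (I J J' : Finset ℕ) (hIJ : PosFact.IsKrasner n I J)
    (L M : ℕ → Finset ℕ) (L₂ : ℕ → ℕ → Finset ℕ) :
    (∃ C : Finset PosFact.Word, PosFact.IsMaximalCode (C : Set PosFact.Word) ∧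
        PosFact.IsPositiveFactorization (PosFact.polyP I L L₂) (PosFact.polyS J J' M) C) ↔
      ((∀ i ∈ I, ∀ l ∈ L i, ∀ j ∈ J' ∩ J,
          PosFact.CoeffLE 0
            (PosFact.pPow (L₂ i l) * (Polynomial.X - 1) * PosFact.pPow (M j)
              + PosFact.pPow (L₂ i l) + PosFact.pPow (M j))) ∧
        (∀ i ∈ I, ∀ l ∈ L i, ∀ j ∈ J' \ J,
          PosFact.CoeffLE 0
            (PosFact.pPow (L₂ i l) * (Polynomial.X - 1) * PosFact.pPow (M j)
              + PosFact.pPow (M j))) ∧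
        (∀ i ∈ I, PosFact.CoeffLE 0 (PosFact.hajos (L i) J)) ∧
        J'.filter (fun j => M j ≠ ∅) ⊆ I.biUnion (fun i => PosFact.expSet (L i) J) ∧
        (∀ j ∈ J',
          PosFact.CoeffLE
            (PosFact.pPow (M j) * (Polynomial.X - 1) * PosFact.pPow I
              + PosFact.pPow (I.filter (fun i => j ∈ PosFact.expSet (L i) J)))
            (PosFact.hajos (M j) I) ∧
          PosFact.CoeffLE 0
            (PosFact.pPow (M j) * (Polynomial.X - 1) * PosFact.pPow I
              + PosFact.pPow (I.filter (fun i => j ∈ PosFact.expSet (L i) J)))) ∧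
        (∀ i ∈ I, ∀ l ∈ L i, PosFact.CoeffLE 0 (PosFact.hajos (L₂ i l) J)) ∧
        (∀ i ∈ I, ∀ j ∈ J', ∀ l ∈ L i,
          (PosFact.hajos (L i) (M j)).coeff l < 0 → j ∈ PosFact.expSet (L₂ i l) J)) := by
  rw [exists_positiveFactorization_iff hIJ, isNonneg_iff hIJ]
  have hcomm : ∀ j, pPow I * (Polynomial.X - 1) * pPow (M j)
      = pPow (M j) * (Polynomial.X - 1) * pPow I := fun j => by ring
  have hle : ∀ j ∈ J', CoeffLE (pPow (M j) * (Polynomial.X - 1) * pPow I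
      + pPow (I.filter fun i => j ∈ expSet (L i) J)) (hajos (M j) I) :=
    fun j _ => coeffLE_hajos_of_subset (Finset.filter_subset _ _)
  simp only [coeffLE_zero_iff, hcomm]
  constructor
  · rintro ⟨h1, h2, h3⟩
    have hL : ∀ i ∈ I, ∀ k, 0 ≤ (hajos (L i) J).coeff k := by
      intro i hi k
      -- For fixed `k`, the one-`b` inequalities are taken as a polynomial in the exponent before
      -- `b`.
      refine hIJ.nonneg_of_sum_add_nonneg (fun p => (hajos (L p) J).coeff k)
        (if k ∈ J' then pPow (M k) else 0) (fun m => ?_) (fun p => ?_) hi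
      · split_ifs
        · exact pPow_coeff_nonneg _ _
        · simp
      · have := h1 p k
        rw [← hcomm] at this
        by_cases hk : k ∈ J' <;> simpa [hk] using this
    have hI : ∀ j ∈ J', ∀ k, 0 ≤ (pPow (M j) * (Polynomial.X - 1) * pPow I
        + pPow (I.filter fun i => j ∈ expSet (L i) J)).coeff k := by
      intro j hj k
      have := h1 k j
      rw [if_pos hj] at this
      rw [Polynomial.coeff_add, hIJ.coeff_pPow_filter_expSet hL]
      linarith
    have hW := fun i (hi : i ∈ I) j (hj : j ∈ J') =>
      hIJ.coeff_hajos_add_mem (hL i hi) fun k => (hI j hj k).trans (hle j hj k)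
    have h6 : ∀ i ∈ I, ∀ l ∈ L i, ∀ k, 0 ≤ (hajos (L₂ i l) J).coeff k := by
      intro i hi l hl k
      have := h2 i hi l k
      rw [if_pos hl] at this
      split_ifs at this with hk
      -- On `L i` the upper bound `1` makes the other summand at most `0`, so it cannot hide a
      -- negative coefficient.
      · have := (hW i hi k hk l).2
        rw [pPow_coeff, if_pos hl] at this
        linarith
      · linarith
    refine ⟨fun i hi l hl j hj k => ?_, fun i hi l hl j hj k => ?_, hL, fun j hj => ?_,
      fun j hj => ⟨hle j hj, hI j hj⟩, h6, fun i hi j hj l hl hneg => ?_⟩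
    · have hj := Finset.mem_inter.1 hj
      have := h3 i hi l hl k j
      rw [if_pos hj.1, if_pos hj.2, hajos, Polynomial.coeff_add] at this
      rw [Polynomial.coeff_add, Polynomial.coeff_add]
      linarith
    · have hj := Finset.mem_sdiff.1 hj
      have := h3 i hi l hl k j
      rwa [if_pos hj.1, if_neg hj.2, add_zero] at this
    · obtain ⟨hj, hMj⟩ := Finset.mem_filter.1 hj
      by_contra hnot
      simp only [Finset.mem_biUnion, not_exists, not_and] at hnot
      -- If `j` lies in no `R_i`, then condition 5 reads `a^{M_j} (a - 1) a^I ≥ 0`, forcing `M_j` to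
      -- be empty.
      have hf : (I.filter fun i => j ∈ expSet (L i) J) = ∅ :=
        Finset.filter_eq_empty_iff.2 fun i hi => hnot i hi
      have hpos := hI j hj
      rw [hf] at hpos
      exact hMj (hIJ.symm.eq_empty_of_nonneg (by simpa [pPow, powSet] using hpos))
    · have := h2 i hi l j
      rw [if_pos hj, if_pos hl] at this
      rw [mem_expSet]
      omega
  · rintro ⟨c1, c2, hL, -, c5, h6, c7⟩
    have hI := fun j (hj : j ∈ J') => (c5 j hj).2
    have hW := fun i (hi : i ∈ I) j (hj : j ∈ J') =>
      hIJ.coeff_hajos_add_mem (hL i hi) fun k => (hI j hj k).trans (hle j hj k)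
    refine ⟨fun p q => ?_, fun p hp m q => ?_, fun p hp m hm r q => ?_⟩
    · by_cases hq : q ∈ J'
      · have := hI q hq p
        rw [Polynomial.coeff_add, hIJ.coeff_pPow_filter_expSet hL] at this
        rw [if_pos hq]
        linarith
      · rw [if_neg hq, add_zero]
        split_ifs with hp
        · exact hL p hp q
        · exact le_rfl
    · by_cases hq : q ∈ J'
      · have hw := (hW p hp q hq m).1
        rw [pPow_coeff] at hw
        rw [if_pos hq]
        by_cases hm : m ∈ L p
        -- On `L p` the first summand is at least `-1`; when it is negative, condition 7 makes the
        -- second nonzero, hence at least `1`.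
        · have h60 := h6 p hp m hm q
          have h7 := c7 p hp q hq m hm
          rw [mem_expSet] at h7
          rw [if_pos hm] at hw ⊢
          omega
        · rw [if_neg hm] at hw ⊢
          exact hw
      · rw [if_neg hq, zero_add]
        split_ifs with hm
        · exact h6 p hp m hm q
        · exact le_rfl
    · by_cases hq : q ∈ J'
      · by_cases hqJ : q ∈ J
        · have := c1 p hp m hm q (Finset.mem_inter.2 ⟨hq, hqJ⟩) r
          rw [Polynomial.coeff_add, Polynomial.coeff_add] at this
          rw [if_pos hq, if_pos hqJ, hajos, Polynomial.coeff_add]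
          linarith
        · rw [if_pos hq, if_neg hqJ, add_zero]
          exact c2 p hp m hm q (Finset.mem_sdiff.2 ⟨hq, hqJ⟩) r
      · rw [if_neg hq, zero_add]
        split_ifs
        · exact pPow_coeff_nonneg _ _
        · exact le_rfl
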